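/- Let $d\ge 1$ and let $C_c(\mathbb R^d)$ (compactly supported continuous complex functions) act on $L^2(\mathbb R^d)$ by multiplication. A bounded operator $T$ on $L^2(\mathbb R^d)$ is called *locally compact* if $Tf$ and $fT$ are compact for every $f\in C_c(\mathbb R^d)$, and is said to have *finite propagation* if there is $R>0$ such that $fTg=0$ for all $f,g\in C_c(\mathbb R^d)$ with $\inf\{\|x-y\| : x\in\operatorname{supp} f,\ y\in\operatorname{supp} g\}>R$ (the infimum over the empty set being $+\infty$). The Roe algebra $C^*(\mathbb R^d)$ is the norm closure, in the bounded operators on $L^2(\mathbb R^d)$, of the $*$-algebra of locally compact operators with finite propagation. A set $\mathfrak D\subseteq\mathbb R^d$ is *uniformly discrete* if for some $r>0$ the open balls $B_r(\gamma)$, $\gamma\in\mathfrak D$, are pairwise disjoint. Let $\mathcal H\subseteq L^2(\mathbb R^d)$ be a closed subspace, let $s>d/2$, let $\mathfrak D\subseteq\mathbb R^d$ be uniformly discrete, and let $\{\psi_\gamma\}_{\gamma\in\mathfrak D}$ be an $s$-localized generalized Wannier basis of $\mathcal H$, i.e. an orthonormal basis of $\mathcal H$ for which there is $M>0$ with $$\int_{\mathbb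 R^d}\langle x-\gamma\rangle^{2s}\,|\psi_\gamma(x)|^2\,dx\le M\qquad\text{for all }\gamma\in\mathfrak D,\qquad \langle x\rangle=(1+\|x\|^2)^{1/2}.$$ Then the orthogonal projection onto $\mathcal H$, which is $P_{\mathcal H}=\sum_{\gamma\in\mathfrak D}|\psi_\gamma\rangle\langle\psi_\gamma|$ (strongly convergent sum), belongs to $C^*(\mathbb R^d)$, and its class $[P_{\mathcal H}]=[P_{\mathcal H}]-[0]$ in $K_0(C^*(\mathbb R^d))$ is zero. Here, for a C$^*$-algebra $A$ with unitization $A^+$, $K_0(A)$ is the kernel of the map $K_0(A^+)\to K_0(\mathbb C)$ induced by $A^+\to A^+/A=\mathbb C$, and $K_0$ of a unital C$^*$-algebra is the Grothendieck group of the monoid of Murray–von Neumann classes of projections in matrices over it, under orthogonal direct sum. -/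

import Mathlib

open MeasureTheory
open scoped ENNReal CompactlySupported Matrix

/-! ## K-theory of C⋆-algebras via projections in matrix algebras -/

namespace KTheory

section Unital

variable {R : Type*} [Ring R] [StarRing R]

/-- Murray–von Neumann equivalence of square matrices, possibly of different sizes. -/
def MvN {m n : Type*} [Fintype m] [Fintype n] (p : Matrix m m R) (q : Matrix n n R) : Prop :=
  ∃ v : Matrix n m R, vᴴ * v = p ∧ v * vᴴ = q

theorem MvN.refl {m : Type*} [Fintype m] {p : Matrix m m R} (hp : IsStarProjection p) :
    MvN p p := by
  have h1 : pᴴ = p := hp.isSelfAdjoint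
  have h2 : p * p = p := hp.isIdempotentElem
  exact ⟨p, by rw [h1, h2], by rw [h1, h2]⟩

theorem MvN.symm {m n : Type*} [Fintype m] [Fintype n] {p : Matrix m m R} {q : Matrix n n R}
    (h : MvN p q) : MvN q p := by
  obtain ⟨v, h1, h2⟩ := h
  exact ⟨vᴴ, by simpa using h2, by simpa using h1⟩

theorem MvN.trans {m n k : Type*} [Fintype m] [Fintype n] [Fintype k]
    {p : Matrix m m R} {q : Matrix n n R} {r : Matrix k k R}
    (hp : IsStarProjection p) (hr : IsStarProjection r) (h : MvN p q) (h' : MvN q r) :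
    MvN p r := by
  obtain ⟨v, h1, h2⟩ := h
  obtain ⟨w, h3, h4⟩ := h'
  have e1 : p * p = p := hp.isIdempotentElem
  have e2 : r * r = r := hr.isIdempotentElem
  refine ⟨w * v, ?_, ?_⟩
  · calc (w * v)ᴴ * (w * v) = vᴴ * (wᴴ * w) * v := by
          rw [Matrix.conjTranspose_mul]; simp only [Matrix.mul_assoc]
      _ = (vᴴ * v) * (vᴴ * v) := by rw [h3, ← h2]; simp only [Matrix.mul_assoc]
      _ = p := by rw [h1, e1]
  · calc (w * v) * (w * v)ᴴ = w * (v * vᴴ) * wᴴ := by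
          rw [Matrix.conjTranspose_mul]; simp only [Matrix.mul_assoc]
      _ = (w * wᴴ) * (w * wᴴ) := by rw [h2, ← h3]; simp only [Matrix.mul_assoc]
      _ = r := by rw [h4, e2]

theorem MvN.reindex {m n : Type*} [Fintype m] [Fintype n] (e : m ≃ n) {p : Matrix m m R}
    (hp : IsStarProjection p) : MvN p (Matrix.reindex e e p) := by
  have h1 : pᴴ = p := hp.isSelfAdjoint
  have h2 : p * p = p := hp.isIdempotentElem
  refine ⟨p.submatrix e.symm id, ?_, ?_⟩
  · rw [Matrix.conjTranspose_submatrix, h1, Matrix.submatrix_mul_equiv, h2, Matrix.submatrix_id_id]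
  · rw [Matrix.conjTranspose_submatrix, h1, Matrix.reindex_apply]
    have := Matrix.submatrix_mul_equiv p p e.symm (Equiv.refl m) e.symm
    rw [h2] at this
    exact this

theorem MvN.fromBlocks {m n m' n' : Type*} [Fintype m] [Fintype n] [Fintype m'] [Fintype n']
    {p : Matrix m m R} {q : Matrix n n R} {p' : Matrix m' m' R} {q' : Matrix n' n' R}
    (h : MvN p p') (h' : MvN q q') :
    MvN (Matrix.fromBlocks p 0 0 q) (Matrix.fromBlocks p' 0 0 q') := by
  obtain ⟨v, h1, h2⟩ := h
  obtain ⟨w, h3, h4⟩ := h'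
  exact ⟨Matrix.fromBlocks v 0 0 w,
    by simp [Matrix.fromBlocks_conjTranspose, Matrix.fromBlocks_multiply, h1, h3],
    by simp [Matrix.fromBlocks_conjTranspose, Matrix.fromBlocks_multiply, h2, h4]⟩

theorem isStarProjection_reindex {m n : Type*} [Fintype m] [Fintype n] (e : m ≃ n)
    {p : Matrix m m R} (hp : IsStarProjection p) : IsStarProjection (Matrix.reindex e e p) := by
  have h1 : pᴴ = p := hp.isSelfAdjoint
  have h2 : p * p = p := hp.isIdempotentElem
  refine ⟨?_, ?_⟩
  · change Matrix.reindex e e p * Matrix.reindex e e p = Matrix.reindex e e p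
    rw [Matrix.reindex_apply, Matrix.submatrix_mul_equiv, h2]
  · change (Matrix.reindex e e p)ᴴ = Matrix.reindex e e p
    rw [Matrix.reindex_apply, Matrix.conjTranspose_submatrix, h1]

theorem isStarProjection_fromBlocks {m n : Type*} [Fintype m] [Fintype n]
    {p : Matrix m m R} {q : Matrix n n R} (hp : IsStarProjection p) (hq : IsStarProjection q) :
    IsStarProjection (Matrix.fromBlocks p 0 0 q) := by
  have h1 : pᴴ = p := hp.isSelfAdjoint
  have h2 : p * p = p := hp.isIdempotentElem
  have h3 : qᴴ = q := hq.isSelfAdjoint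
  have h4 : q * q = q := hq.isIdempotentElem
  refine ⟨?_, ?_⟩
  · change Matrix.fromBlocks p 0 0 q * Matrix.fromBlocks p 0 0 q = Matrix.fromBlocks p 0 0 q
    simp [Matrix.fromBlocks_multiply, h2, h4]
  · change (Matrix.fromBlocks p 0 0 q)ᴴ = Matrix.fromBlocks p 0 0 q
    simp [Matrix.fromBlocks_conjTranspose, h1, h3]

variable (R) in
/-- Projections in the matrix algebras `Mₙ(R)`, `n : ℕ`. -/
structure MatProj where
  /-- The size of the matrix. -/
  size : ℕ
  /-- The underlying matrix. -/
  mat : Matrix (Fin size) (Fin size) R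
  isProj : IsStarProjection mat

/-- Orthogonal direct sum `p ⊕ q = diag(p, q)` of matrix projections. -/
def MatProj.add (p q : MatProj R) : MatProj R :=
  ⟨p.size + q.size, Matrix.reindex finSumFinEquiv finSumFinEquiv
      (Matrix.fromBlocks p.mat 0 0 q.mat),
    isStarProjection_reindex _ (isStarProjection_fromBlocks p.isProj q.isProj)⟩

/-- Murray–von Neumann equivalence of matrix projections. -/
instance MatProj.setoid : Setoid (MatProj R) where
  r p q := MvN p.mat q.mat
  iseqv := ⟨fun p => MvN.refl p.isProj, MvN.symm, fun {p _ r} h h' => MvN.trans p.isProj r.isProj h h'⟩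

theorem MatProj.add_mvN (p q : MatProj R) :
    MvN (p.add q).mat (Matrix.fromBlocks p.mat 0 0 q.mat) :=
  (MvN.reindex _ (isStarProjection_fromBlocks p.isProj q.isProj)).symm

theorem MatProj.add_equiv_of {p q r : MatProj R}
    (h : MvN (Matrix.fromBlocks p.mat 0 0 q.mat) r.mat) : p.add q ≈ r :=
  MvN.trans (p.add q).isProj r.isProj (p.add_mvN q) h

variable (R) in
/-- The set of Murray–von Neumann classes of projections in matrices over `R`. -/
def ProjClass : Type _ := Quotient (MatProj.setoid (R := R))

/-- The class of a matrix projection. -/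
def ProjClass.mk (p : MatProj R) : ProjClass R := Quotient.mk _ p

instance ProjClass.instAdd : Add (ProjClass R) where
  add := Quotient.map₂ MatProj.add fun p p' h q q' h' =>
    MatProj.add_equiv_of (MvN.trans (isStarProjection_fromBlocks p.isProj q.isProj)
      (p'.add q').isProj (MvN.fromBlocks h h') (p'.add_mvN q').symm)

instance ProjClass.instZero : Zero (ProjClass R) where
  zero := ProjClass.mk ⟨0, 0, .zero _⟩

/-- Classes of matrix projections form a commutative monoid under orthogonal direct sum. -/
instance ProjClass.addCommMonoid : AddCommMonoid (ProjClass R) where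
  nsmul := nsmulRec
  add_assoc := by
    rintro ⟨p⟩ ⟨q⟩ ⟨r⟩
    refine Quotient.sound (MatProj.add_equiv_of ?_)
    have hp := p.isProj
    have hq := q.isProj
    have hr := r.isProj
    have h3 := isStarProjection_fromBlocks (isStarProjection_fromBlocks hp hq) hr
    have h3' := isStarProjection_fromBlocks hp (isStarProjection_fromBlocks hq hr)
    have a1 := MvN.fromBlocks (p.add_mvN q) (MvN.refl hr)
    have a2 := MvN.fromBlocks (MvN.refl hp) (q.add_mvN r)
    have a3 := MvN.reindex (Equiv.sumAssoc _ _ _) h3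
    have e : Matrix.reindex (Equiv.sumAssoc (Fin p.size) (Fin q.size) (Fin r.size)) (Equiv.sumAssoc _ _ _)
        (Matrix.fromBlocks (Matrix.fromBlocks p.mat 0 0 q.mat) 0 0 r.mat) =
        Matrix.fromBlocks p.mat 0 0 (Matrix.fromBlocks q.mat 0 0 r.mat) := by
      ext (i | i | i) (j | j | j) <;> simp
    rw [e] at a3
    have h4 := isStarProjection_fromBlocks (p.add q).isProj hr
    have h5 := isStarProjection_fromBlocks hp (q.add r).isProj
    exact MvN.trans h4 (p.add (q.add r)).isProj (MvN.trans h4 h3' a1 a3)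
      (MvN.trans h3' (p.add (q.add r)).isProj a2.symm (p.add_mvN (q.add r)).symm)
  zero_add := by
    rintro ⟨p⟩
    refine Quotient.sound (MatProj.add_equiv_of ?_)
    have h := isStarProjection_fromBlocks (p := (0 : Matrix (Fin 0) (Fin 0) R)) (.zero _) p.isProj
    have a := MvN.reindex (Equiv.emptySum (Fin 0) (Fin p.size)) h
    have e : Matrix.reindex (Equiv.emptySum (Fin 0) (Fin p.size)) (Equiv.emptySum (Fin 0) (Fin p.size))
        (Matrix.fromBlocks 0 0 0 p.mat) = p.mat := by
      ext i j; simp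
    rwa [e] at a
  add_zero := by
    rintro ⟨p⟩
    refine Quotient.sound (MatProj.add_equiv_of ?_)
    have h := isStarProjection_fromBlocks (q := (0 : Matrix (Fin 0) (Fin 0) R)) p.isProj (.zero _)
    have a := MvN.reindex (Equiv.sumEmpty (Fin p.size) (Fin 0)) h
    have e : Matrix.reindex (Equiv.sumEmpty (Fin p.size) (Fin 0)) (Equiv.sumEmpty (Fin p.size) (Fin 0))
        (Matrix.fromBlocks p.mat 0 0 0) = p.mat := by
      ext i j; simp
    rwa [e] at a
  add_comm := by
    rintro ⟨p⟩ ⟨q⟩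
    refine Quotient.sound (MatProj.add_equiv_of ?_)
    have h := isStarProjection_fromBlocks p.isProj q.isProj
    have h' := isStarProjection_fromBlocks q.isProj p.isProj
    have a := MvN.reindex (Equiv.sumComm _ _) h
    have e : Matrix.reindex (Equiv.sumComm (Fin p.size) (Fin q.size)) (Equiv.sumComm _ _)
        (Matrix.fromBlocks p.mat 0 0 q.mat) = Matrix.fromBlocks q.mat 0 0 p.mat := by
      ext (i | i) (j | j) <;> simp
    rw [e] at a
    exact MvN.trans h (q.add p).isProj a (q.add_mvN p).symm

variable (R) in
/-- The Grothendieck group of Murray–von Neumann classes of projections in matrices over a unital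
⋆-ring `R`. For a unital C⋆-algebra this is its `K₀`-group. -/
abbrev K00 : Type _ := Algebra.GrothendieckAddGroup (ProjClass R)

/-- The class in `K00 R` of a matrix projection. -/
noncomputable def K00.cls (p : MatProj R) : K00 R := Algebra.GrothendieckAddGroup.of (ProjClass.mk p)

end Unital

section Functoriality

variable {R S : Type*} [Ring R] [StarRing R] [Algebra ℂ R] [Ring S] [StarRing S] [Algebra ℂ S]

theorem map_conjTranspose' {m n : Type*} (f : R →⋆ₐ[ℂ] S) (p : Matrix m n R) :
    (p.map f)ᴴ = pᴴ.map f := by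
  ext i j; simp [map_star]

/-- Entrywise image of a matrix projection under a ⋆-homomorphism. -/
def MatProj.map (f : R →⋆ₐ[ℂ] S) (p : MatProj R) : MatProj S :=
  ⟨p.size, p.mat.map f, by
    have h1 : p.matᴴ = p.mat := p.isProj.isSelfAdjoint
    have h2 : p.mat * p.mat = p.mat := p.isProj.isIdempotentElem
    refine ⟨?_, ?_⟩
    · change p.mat.map f * p.mat.map f = p.mat.map f
      rw [← Matrix.map_mul, h2]
    · change (p.mat.map f)ᴴ = p.mat.map f
      rw [map_conjTranspose', h1]⟩

/-- The monoid homomorphism on classes of projections induced by a ⋆-homomorphism. -/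
def ProjClass.map (f : R →⋆ₐ[ℂ] S) : ProjClass R →+ ProjClass S where
  toFun := Quotient.map (MatProj.map f) fun p q h => by
    obtain ⟨v, h1, h2⟩ := h
    refine ⟨v.map f, ?_, ?_⟩
    · change (v.map f)ᴴ * v.map f = p.mat.map f
      rw [map_conjTranspose', ← Matrix.map_mul, h1]
    · change v.map f * (v.map f)ᴴ = q.mat.map f
      rw [map_conjTranspose', ← Matrix.map_mul, h2]
  map_zero' := by
    refine congrArg (Quotient.mk _) ?_
    simp only [MatProj.map]
    congr 1
    exact Subsingleton.elim _ _
  map_add' := by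
    rintro ⟨p⟩ ⟨q⟩
    refine congrArg (Quotient.mk _) ?_
    simp only [MatProj.map, MatProj.add]
    congr 1
    simp [Matrix.reindex_apply, ← Matrix.submatrix_map, Matrix.fromBlocks_map, Matrix.map_zero]
    rfl

/-- The group homomorphism `K00 R → K00 S` induced by a unital ⋆-homomorphism. -/
noncomputable def K00.map (f : R →⋆ₐ[ℂ] S) : K00 R →+ K00 S :=
  Algebra.GrothendieckAddGroup.lift (Algebra.GrothendieckAddGroup.of.comp (ProjClass.map f))

theorem K00.map_cls (f : R →⋆ₐ[ℂ] S) (p : MatProj R) :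
    K00.map f (K00.cls p) = K00.cls (p.map f) :=
  DFunLike.congr_fun (Algebra.GrothendieckAddGroup.lift.symm_apply_apply
    (Algebra.GrothendieckAddGroup.of.comp (ProjClass.map f))) (ProjClass.mk p)

end Functoriality

section NonUnital

variable (A : Type*) [NonUnitalCStarAlgebra A]

/-- The quotient ⋆-homomorphism `A⁺ → ℂ`, `(z, a) ↦ z`, on the unitization of `A`. -/
noncomputable def scalarPart : Unitization ℂ A →⋆ₐ[ℂ] ℂ where
  toAlgHom := Unitization.fstHom ℂ A
  map_star' _ := rfl

/-- `K₀(A) = ker (K₀(A⁺) → K₀(ℂ))` for a (not necessarily unital) C⋆-algebra `A`. -/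
noncomputable def K0 : AddSubgroup (K00 (Unitization ℂ A)) := (K00.map (scalarPart A)).ker

variable {A}

/-- A projection of `A`, seen as a `1 × 1` matrix projection over the unitization of `A`. -/
noncomputable def unitizationProj (p : A) (hp : IsStarProjection p) :
    MatProj (Unitization ℂ A) :=
  ⟨1, Matrix.of fun _ _ => (p : Unitization ℂ A), by
    have h1 : star p = p := hp.isSelfAdjoint
    have h2 : p * p = p := hp.isIdempotentElem
    refine ⟨?_, ?_⟩
    · refine Matrix.ext fun i j => ?_
      rw [Matrix.mul_apply]
      simp [← Unitization.inr_mul, h2]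
    · refine Matrix.ext fun i j => ?_
      rw [Matrix.star_apply]
      simp [← Unitization.inr_star, h1]⟩

/-- The class `[p] - [0] ∈ K₀(A)` of a projection `p ∈ A`. -/
noncomputable def K0.cls (p : A) (hp : IsStarProjection p) : K0 A :=
  ⟨K00.cls (unitizationProj p hp) - K00.cls (unitizationProj (0 : A) (.zero A)), by
    have e : (unitizationProj p hp).map (scalarPart A) =
        (unitizationProj (0 : A) (.zero A)).map (scalarPart A) := by
      simp only [MatProj.map, unitizationProj]
      congr 1
    change K00.map (scalarPart A) _ = 0
    rw [map_sub, K00.map_cls, K00.map_cls, e, sub_self]⟩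

end NonUnital

end KTheory

/-! ## The Roe C⋆-algebra of Euclidean space -/

namespace Roe

/-- Position space `ℝᵈ` with the Euclidean norm. -/
abbrev Pos (d : ℕ) : Type := EuclideanSpace ℝ (Fin d)

/-- The Hilbert space `L²(ℝᵈ)`. -/
abbrev L2 (d : ℕ) : Type := Lp ℂ 2 (volume : Measure (Pos d))

/-- Bounded operators on `L²(ℝᵈ)`. -/
abbrev BL2 (d : ℕ) : Type := L2 d →L[ℂ] L2 d

variable {d : ℕ}

theorem memLp_top (f : C_c(Pos d, ℂ)) : MemLp f ∞ (volume : Measure (Pos d)) :=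
  f.continuous.memLp_top_of_hasCompactSupport f.hasCompactSupport _

/-- Multiplication by `f ∈ C_c(ℝᵈ)`, as a bounded operator on `L²(ℝᵈ)`. -/
noncomputable def mulOp (f : C_c(Pos d, ℂ)) : BL2 d :=
  (ContinuousLinearMap.mul ℂ ℂ).holderL volume ∞ 2 2 (memLp_top f).toLp

theorem mulOp_ae (f : C_c(Pos d, ℂ)) (φ : L2 d) :
    mulOp f φ =ᵐ[volume] fun x => f x * φ x := by
  have h := (ContinuousLinearMap.mul ℂ ℂ).coeFn_holder (r := 2) (memLp_top f).toLp φ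
  filter_upwards [h, (memLp_top f).coeFn_toLp] with x hx hx'
  rw [← hx', ← ContinuousLinearMap.mul_apply' ℂ ℂ, ← hx]
  rfl

/-- The distance `inf {‖x - y‖ : x ∈ A, y ∈ B}` of two sets, with value `∞` if one is empty. -/
noncomputable def setDist (A B : Set (Pos d)) : ℝ≥0∞ := ⨅ x ∈ A, ⨅ y ∈ B, edist x y

/-- `T` is locally compact: `T f` and `f T` are compact operators for all `f ∈ C_c(ℝᵈ)`. -/
def IsLocallyCompact (T : BL2 d) : Prop :=
  ∀ f : C_c(Pos d, ℂ), IsCompactOperator (T * mulOp f) ∧ IsCompactOperator (mulOp f * T)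

/-- `T` has finite propagation: for some `R > 0`, `f T g = 0` for all `f, g ∈ C_c(ℝᵈ)` whose
supports have distance larger than `R`. -/
def HasFinitePropagation (T : BL2 d) : Prop :=
  ∃ R : ℝ, 0 < R ∧ ∀ f g : C_c(Pos d, ℂ),
    ENNReal.ofReal R < setDist (tsupport f) (tsupport g) → mulOp f * T * mulOp g = 0

theorem mulOp_star (f : C_c(Pos d, ℂ)) : mulOp (star f) = star (mulOp f) := by
  rw [ContinuousLinearMap.star_eq_adjoint, ContinuousLinearMap.eq_adjoint_iff]
  intro φ χ
  rw [L2.inner_def, L2.inner_def]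
  refine integral_congr_ae ?_
  filter_upwards [mulOp_ae (star f) φ, mulOp_ae f χ] with x h1 h2
  rw [h1, h2]
  simp
  ring

theorem setDist_comm (A B : Set (Pos d)) : setDist A B = setDist B A := by
  unfold setDist
  apply le_antisymm <;>
  · refine le_iInf₂ fun y hy => le_iInf₂ fun x hx => ?_
    rw [edist_comm]
    exact iInf₂_le_of_le x hx (iInf₂_le y hy)

theorem tsupport_star (f : C_c(Pos d, ℂ)) : tsupport (star f : C_c(Pos d, ℂ)) = tsupport f := by
  unfold tsupport
  congr 1
  ext x
  simp

/-- The adjoint of a compact operator on a Hilbert space is compact. -/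
theorem isCompactOperator_star {T : BL2 d} (hT : IsCompactOperator T) :
    IsCompactOperator (star T : BL2 d) := by
  rw [ContinuousLinearMap.star_eq_adjoint]
  have hTT : IsCompactOperator (T ∘L T.adjoint) := hT.comp_clm _
  have hc := hTT.isCompact_closure_image_closedBall (f := (T ∘L T.adjoint).toLinearMap) 1
  refine (isCompactOperator_iff_isCompact_closure_image_closedBall
    (T.adjoint).toLinearMap one_pos).2 ?_
  refine TotallyBounded.isCompact_of_isClosed ?_ isClosed_closure
  refine TotallyBounded.closure ?_
  have htb : TotallyBounded ((T ∘L T.adjoint) '' Metric.closedBall 0 1) :=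
    hc.totallyBounded.subset subset_closure
  rw [Metric.totallyBounded_iff]
  intro ε hε
  obtain ⟨t, ht, htf, hcov⟩ := Metric.finite_approx_of_totallyBounded htb (ε ^ 2 / 2) (by positivity)
  have ht' : ∀ z : L2 d, z ∈ t → ∃ u : L2 d, u ∈ Metric.closedBall (0 : L2 d) 1 ∧
      (T ∘L T.adjoint) u = z := fun z hz => ht hz
  choose! u hu hut using ht'
  refine ⟨(fun z => T.adjoint (u z)) '' t, htf.image _, ?_⟩
  rintro _ ⟨x, hx, rfl⟩
  obtain ⟨z, hz, hxz⟩ := Set.mem_iUnion₂.1 (hcov ⟨x, hx, rfl⟩)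
  refine Set.mem_iUnion₂.2 ⟨_, ⟨z, hz, rfl⟩, ?_⟩
  rw [Metric.mem_ball, dist_eq_norm] at hxz ⊢
  rw [← hut z hz, ← map_sub] at hxz
  change ‖T.adjoint x - T.adjoint (u z)‖ < ε
  rw [← map_sub]
  have hn : ‖x - u z‖ ≤ 2 := by
    have h1 : ‖x‖ ≤ 1 := by simpa using hx
    have h2 : ‖u z‖ ≤ 1 := by simpa using hu z hz
    linarith [norm_sub_le x (u z)]
  have key : ‖T.adjoint (x - u z)‖ ^ 2 ≤ ‖x - u z‖ * ‖T (T.adjoint (x - u z))‖ := by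
    rw [← inner_self_eq_norm_sq (𝕜 := ℂ), ContinuousLinearMap.adjoint_inner_left]
    exact (RCLike.re_le_norm _).trans (norm_inner_le_norm _ _)
  have hxz' : ‖T (T.adjoint (x - u z))‖ < ε ^ 2 / 2 := hxz
  have : ‖T.adjoint (x - u z)‖ ^ 2 < ε ^ 2 := by
    nlinarith [norm_nonneg (T (T.adjoint (x - u z)))]
  exact lt_of_pow_lt_pow_left₀ 2 hε.le this

theorem mulOp_mulOp (f g : C_c(Pos d, ℂ)) : mulOp f * mulOp g = mulOp (f * g) := by
  ext1 φ
  refine Lp.ext ?_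
  filter_upwards [mulOp_ae f (mulOp g φ), mulOp_ae g φ, mulOp_ae (f * g) φ] with x h1 h2 h3
  rw [h3, mul_apply_eq_comp, h1, h2]
  simp [mul_assoc]

theorem mulOp_sub (f g : C_c(Pos d, ℂ)) : mulOp (f - g) = mulOp f - mulOp g := by
  ext1 φ
  refine Lp.ext ?_
  rw [sub_apply]
  filter_upwards [mulOp_ae f φ, mulOp_ae g φ, mulOp_ae (f - g) φ,
    Lp.coeFn_sub (mulOp f φ) (mulOp g φ)] with x h1 h2 h3 h4
  rw [h4, h3, Pi.sub_apply, h1, h2]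
  simp [sub_mul]

/-- An operator that vanishes after all multiplications by functions in `C_c(ℝᵈ)` is zero. -/
theorem eq_zero_of_mul_mulOp {T : BL2 d} (hT : ∀ k : C_c(Pos d, ℂ), T * mulOp k = 0) : T = 0 := by
  ext1 φ
  have hd : φ ∈ closure {χ : L2 d | T χ = 0} := by
    rw [Metric.mem_closure_iff]
    intro ε hε
    obtain ⟨g, hgs, hg, hgc, hgm⟩ := (Lp.memLp φ).exists_hasCompactSupport_eLpNorm_sub_le
      (by norm_num) (ε := ENNReal.ofReal (ε / 2)) (by simpa using hε)
    obtain ⟨k, hk1, -, hkc, -⟩ := exists_continuous_one_zero_of_isCompact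
      (s := tsupport g) (t := ∅) hgs isClosed_empty (Set.disjoint_empty _)
    let k' : C_c(Pos d, ℂ) := ⟨⟨fun x => (k x : ℂ), by fun_prop⟩,
      hkc.comp_left (g := fun r : ℝ => (r : ℂ)) (by simp)⟩
    refine ⟨hgm.toLp g, ?_, ?_⟩
    · have : hgm.toLp g = mulOp k' (hgm.toLp g) := by
        refine Lp.ext ?_
        filter_upwards [mulOp_ae k' (hgm.toLp g), hgm.coeFn_toLp] with x h1 h2
        rw [h1, h2]
        by_cases hx : x ∈ tsupport g
        · have : k' x = 1 := by
            change ((k x : ℝ) : ℂ) = 1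
            rw [hk1 hx]; simp
          rw [this, one_mul]
        · rw [image_eq_zero_of_notMem_tsupport hx, mul_zero]
      change T _ = 0
      rw [this, ← mul_apply_eq_comp, hT]
      rfl
    · have h1 : edist φ (hgm.toLp g) ≤ ENNReal.ofReal (ε / 2) := by
        rw [Lp.edist_def]
        refine le_trans (le_of_eq (eLpNorm_congr_ae ?_)) hg
        filter_upwards [hgm.coeFn_toLp] with x hx
        simp [hx]
      have h2 : edist φ (hgm.toLp g) < ENNReal.ofReal ε :=
        h1.trans_lt ((ENNReal.ofReal_lt_ofReal_iff hε).2 (by linarith))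
      rwa [edist_dist, ENNReal.ofReal_lt_ofReal_iff hε] at h2
  have hcl : IsClosed {χ : L2 d | T χ = 0} := isClosed_eq T.continuous continuous_const
  rw [hcl.closure_eq] at hd
  exact hd

theorem HasFinitePropagation.mul {T S : BL2 d} (hT : HasFinitePropagation T)
    (hS : HasFinitePropagation S) : HasFinitePropagation (T * S) := by
  obtain ⟨R₁, hR₁, h1⟩ := hT
  obtain ⟨R₂, hR₂, h2⟩ := hS
  refine ⟨R₁ + R₂ + 4, by positivity, fun f g hfg => ?_⟩
  obtain ⟨h, hh1, hh0, hhc, -⟩ := exists_continuous_one_zero_of_isCompact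
    (s := Metric.cthickening (R₁ + 1) (tsupport f))
    (t := (Metric.thickening (R₁ + 2) (tsupport f))ᶜ)
    (f.hasCompactSupport.isCompact.cthickening) Metric.isOpen_thickening.isClosed_compl
    (Set.disjoint_compl_right_iff_subset.2
      (Metric.cthickening_subset_thickening' (by linarith) (by linarith) _))
  let h' : C_c(Pos d, ℂ) := ⟨⟨fun x => (h x : ℂ), by fun_prop⟩,
    hhc.comp_left (g := fun r : ℝ => (r : ℂ)) (by simp)⟩
  -- `f T = f T h`
  have e1 : mulOp f * T - mulOp f * T * mulOp h' = 0 := by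
    refine eq_zero_of_mul_mulOp fun k => ?_
    have : (mulOp f * T - mulOp f * T * mulOp h') * mulOp k
        = mulOp f * T * mulOp (k - h' * k) := by
      rw [mulOp_sub, ← mulOp_mulOp]; noncomm_ring
    rw [this]
    refine h1 _ _ (lt_of_lt_of_le
      ((ENNReal.ofReal_lt_ofReal_iff (by linarith)).2 (by linarith : R₁ < R₁ + 1)) ?_)
    refine le_iInf₂ fun x hx => le_iInf₂ fun y hy => ?_
    by_contra hlt
    push Not at hlt
    have hopen : IsOpen (Metric.thickening (R₁ + 1) (tsupport f)) := Metric.isOpen_thickening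
    have hy' : y ∈ Metric.thickening (R₁ + 1) (tsupport f) := by
      rw [Metric.mem_thickening_iff]
      refine ⟨x, hx, ?_⟩
      rwa [edist_comm, edist_dist, ENNReal.ofReal_lt_ofReal_iff (by linarith)] at hlt
    obtain ⟨z, hz, hzs⟩ := mem_closure_iff.1 hy _ hopen hy'
    refine hzs ?_
    have : h' z = 1 := by
      change ((h z : ℝ) : ℂ) = 1
      rw [hh1 (Metric.thickening_subset_cthickening _ _ hz)]; simp
    simp [this]
  -- `h S g = 0`
  have e2 : mulOp h' * S * mulOp g = 0 := by
    refine h2 _ _ (lt_of_lt_of_le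
      ((ENNReal.ofReal_lt_ofReal_iff (by linarith)).2 (by linarith : R₂ < R₂ + 1)) ?_)
    refine le_iInf₂ fun y hy => le_iInf₂ fun z hz => ?_
    have hy1 : y ∈ Metric.cthickening (R₁ + 2) (tsupport f) := by
      refine closure_minimal (fun w hw => ?_) Metric.isClosed_cthickening hy
      refine Metric.thickening_subset_cthickening _ _ ?_
      by_contra hw'
      refine hw ?_
      change ((h w : ℝ) : ℂ) = 0
      rw [hh0 hw']; simp
    obtain ⟨x, hx, hyx⟩ := Metric.mem_thickening_iff.1
      (Metric.cthickening_subset_thickening' (by linarith : 0 < R₁ + 3) (by linarith) _ hy1)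
    have hxz : ENNReal.ofReal (R₁ + R₂ + 4) < edist x z :=
      hfg.trans_le (iInf₂_le_of_le x hx (iInf₂_le z hz))
    rw [edist_dist, ENNReal.ofReal_lt_ofReal_iff_of_nonneg (by positivity)] at hxz
    rw [edist_dist]
    refine ENNReal.ofReal_le_ofReal ?_
    have := dist_triangle x y z
    rw [dist_comm y x] at hyx
    linarith
  have e3 : mulOp f * T = mulOp f * T * mulOp h' := sub_eq_zero.1 e1
  calc mulOp f * (T * S) * mulOp g = (mulOp f * T) * S * mulOp g := by noncomm_ring
    _ = mulOp f * T * (mulOp h' * S * mulOp g) := by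
      conv_lhs => rw [e3]
      simp only [mul_assoc]
    _ = 0 := by rw [e2, mul_zero]

theorem HasFinitePropagation.add {T S : BL2 d} (hT : HasFinitePropagation T)
    (hS : HasFinitePropagation S) : HasFinitePropagation (T + S) := by
  obtain ⟨R₁, hR₁, h1⟩ := hT
  obtain ⟨R₂, hR₂, h2⟩ := hS
  refine ⟨max R₁ R₂, lt_max_of_lt_left hR₁, fun f g hfg => ?_⟩
  rw [mul_add, add_mul,
    h1 f g ((ENNReal.ofReal_le_ofReal (le_max_left _ _)).trans_lt hfg),
    h2 f g ((ENNReal.ofReal_le_ofReal (le_max_right _ _)).trans_lt hfg), add_zero]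

theorem HasFinitePropagation.star {T : BL2 d} (hT : HasFinitePropagation T) :
    HasFinitePropagation (star T) := by
  obtain ⟨R, hR, h⟩ := hT
  refine ⟨R, hR, fun f g hfg => ?_⟩
  have h' := h (Star.star g) (Star.star f) (by rwa [tsupport_star, tsupport_star, setDist_comm])
  rw [mulOp_star, mulOp_star] at h'
  have h'' := congrArg Star.star h'
  simpa [mul_assoc] using h''

theorem IsLocallyCompact.star {T : BL2 d} (hT : IsLocallyCompact T) :
    IsLocallyCompact (star T) := by
  intro f
  have h := hT (Star.star f)
  rw [mulOp_star] at h
  have h1 := isCompactOperator_star h.1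
  have h2 := isCompactOperator_star h.2
  rw [star_mul, star_star] at h1 h2
  exact ⟨h2, h1⟩

variable (d) in
/-- `ℂ[ℝᵈ]`: the ⋆-algebra of locally compact operators with finite propagation. -/
noncomputable def algebraicRoe : NonUnitalStarSubalgebra ℂ (BL2 d) where
  carrier := {T | IsLocallyCompact T ∧ HasFinitePropagation T}
  add_mem' := fun {T S} hT hS => ⟨fun f => by
    rw [add_mul, mul_add]
    exact ⟨(hT.1 f).1.add (hS.1 f).1, (hT.1 f).2.add (hS.1 f).2⟩, hT.2.add hS.2⟩
  zero_mem' := ⟨fun f => by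
    rw [zero_mul, mul_zero]
    exact ⟨isCompactOperator_zero, isCompactOperator_zero⟩, 1, one_pos, fun f g _ => by simp⟩
  mul_mem' := fun {T S} hT hS => ⟨fun f => by
    rw [mul_assoc, ← mul_assoc (mulOp f)]
    exact ⟨(hS.1 f).1.clm_comp T, (hT.1 f).2.comp_clm S⟩, hT.2.mul hS.2⟩
  smul_mem' := fun c T hT => ⟨fun f => by
    rw [smul_mul_assoc, mul_smul_comm]
    exact ⟨(hT.1 f).1.smul c, (hT.1 f).2.smul c⟩, by
      obtain ⟨R, hR, h⟩ := hT.2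
      exact ⟨R, hR, fun f g hfg => by rw [mul_smul_comm, smul_mul_assoc, h f g hfg, smul_zero]⟩⟩
  star_mem' := fun hT => ⟨hT.1.star, hT.2.star⟩

variable (d) in
/-- The Roe C⋆-algebra `C⋆(ℝᵈ)`: the norm closure of `ℂ[ℝᵈ]` in the bounded operators. -/
noncomputable def roeAlgebra : NonUnitalStarSubalgebra ℂ (BL2 d) :=
  (algebraicRoe d).topologicalClosure

instance roeAlgebra_isClosed : IsClosed (roeAlgebra d : Set (BL2 d)) :=
  (algebraicRoe d).isClosed_topologicalClosure

variable (d) in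
/-- `C⋆(ℝᵈ)` as a C⋆-algebra in its own right. -/
noncomputable instance roeAlgebra_cstar : NonUnitalCStarAlgebra (roeAlgebra d) :=
  NonUnitalStarSubalgebra.nonUnitalCStarAlgebra (roeAlgebra d)

/-! ### Generalized Wannier bases -/

/-- `D` is uniformly discrete: for some `r > 0` the balls `B_r(γ)`, `γ ∈ D`, are disjoint. -/
def UniformlyDiscrete (D : Set (Pos d)) : Prop :=
  ∃ r : ℝ, 0 < r ∧ D.PairwiseDisjoint fun γ => Metric.ball γ r

/-- The Japanese bracket `⟨x⟩ = (1 + ‖x‖²)^(1/2)`. -/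
noncomputable def bracket (x : Pos d) : ℝ := Real.sqrt (1 + ‖x‖ ^ 2)

/-- `ψ = (ψ_γ)_{γ ∈ D}` is an `s`-localized generalized Wannier basis of `H` on `D`. -/
structure IsGWB (s : ℝ) (H : ClosedSubmodule ℂ (L2 d)) (D : Set (Pos d)) (ψ : D → L2 d) :
    Prop where
  uniformlyDiscrete : UniformlyDiscrete D
  orthonormal : Orthonormal ℂ ψ
  closure_span : (Submodule.span ℂ (Set.range ψ)).topologicalClosure = H.toSubmodule
  localized : ∃ M : ℝ, 0 < M ∧ ∀ γ : D,
    ∫⁻ x, ENNReal.ofReal (bracket (x - (γ : Pos d)) ^ (2 * s) * ‖ψ γ x‖ ^ 2) ≤ ENNReal.ofReal M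

end Roe

/-! ### Swindle criterion in K-theory -/

namespace KTheory

/-! The Wannier basis is replaced by compactly supported functions, which are then pushed to
infinity. Choose orthonormal `η_γ` supported in `B_8(γ)` and put `V = ∑ |ψ_γ⟩⟨η_γ|`. Then `V V* =
P`, and `V* V = Q₀` is the projection onto the span of the `η_γ`. Truncating each `ψ_γ` to `B_R(γ)`
puts `V` into the algebraic Roe algebra, at the cost of an operator of small norm: weighted
Cauchy–Schwarz bounds it by the moment bound `M` times the tail `∑ ⟨x - γ⟩^(-2s)` over `‖x - γ‖ ≥
R`, which is uniformly small in `x` because `2s > d`. Hence `V`, and with it `P`, lies in the Roe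
algebra, and `P ~ Q₀` there (`mem_roeAlgebra_of_isSumOp`). Next, extend `η_γ = η_(γ,0)` to an
orthonormal family `η_(γ,k)`, with `η_(γ,k)` supported near the point `k` units further out on the
ray through `γ`. Only finitely many of these points lie in a bounded region, so the projection `Q`
onto the span of the whole family and the shift `S : η_(γ,k) ↦ η_(γ,k+1)` are locally compact with
finite propagation (`exists_radial_swindle`). From `S* S = Q` and `Q₀ + S S* = Q` follows `[P] + [Q]
= [Q₀] + [Q] = [Q]`, so `[P] = 0`. -/

theorem K00.cls_eq_zero_of_swindle {R : Type*} [Ring R] [StarRing R] {p : MatProj R}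
    (hp : p.size = 1) {e w s : R} (he : IsStarProjection e)
    (hw : ∀ i j, p.mat i j = star w * w) (hs : star s * s = e) (hws : star w * s = 0)
    (hsum : w * star w + s * star s = e) : K00.cls p = 0 := by
  obtain ⟨n, P, hP⟩ := p
  obtain rfl : n = 1 := hp
  let q : MatProj R := ⟨1, Matrix.of fun _ _ => e, by
    refine ⟨Matrix.ext fun i j => ?_, Matrix.ext fun i j => ?_⟩
    · rw [Matrix.mul_apply]
      simpa using he.isIdempotentElem.eq
    · rw [Matrix.star_apply]
      simpa using he.isSelfAdjoint.star_eq⟩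
  have hsw : star s * w = 0 := by simpa using congrArg star hws
  have key : MatProj.add ⟨1, P, hP⟩ q ≈ q := by
    -- The row `v = (w s)` satisfies `v* v = diag(p, e)` and `v v* = w w* + s s* = e`.
    refine MatProj.add_equiv_of ⟨Matrix.of fun _ => Sum.elim (fun _ => w) (fun _ => s), ?_, ?_⟩
    · ext (i | i) (j | j) <;> rw [Matrix.mul_apply]
      · simpa using (hw i j).symm
      · simpa using hws
      · simpa using hsw
      · simpa [q] using hs
    · ext i j
      rw [Matrix.mul_apply]
      simpa [q] using hsum
  have h1 : ProjClass.mk (⟨1, P, hP⟩ : MatProj R) + ProjClass.mk q = ProjClass.mk q :=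
    Quotient.sound key
  have h2 := congrArg Algebra.GrothendieckAddGroup.of h1
  rw [map_add] at h2
  exact add_eq_right.1 h2

/-- An Eilenberg swindle: if `e` is equivalent to `p ⊕ e` inside `A`, then `[p] = 0`. -/
theorem K0.cls_eq_zero_of_swindle {A : Type*} [NonUnitalCStarAlgebra A] {p e w s : A}
    (hp : IsStarProjection p) (he : IsStarProjection e) (hw : star w * w = p)
    (hs : star s * s = e) (hws : star w * s = 0) (hsum : w * star w + s * star s = e) :
    K0.cls p hp = 0 := by
  have he' : IsStarProjection (e : Unitization ℂ A) :=
    ⟨by rw [IsIdempotentElem, ← Unitization.inr_mul, he.isIdempotentElem.eq],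
      by rw [IsSelfAdjoint, ← Unitization.inr_star, he.isSelfAdjoint.star_eq]⟩
  have h1 : K00.cls (unitizationProj p hp) = 0 :=
    K00.cls_eq_zero_of_swindle rfl he' (w := (w : Unitization ℂ A)) (s := (s : Unitization ℂ A))
      (fun i j => by rw [← Unitization.inr_star, ← Unitization.inr_mul, hw]; rfl)
      (by rw [← Unitization.inr_star, ← Unitization.inr_mul, hs])
      (by rw [← Unitization.inr_star, ← Unitization.inr_mul, hws, Unitization.inr_zero])
      (by rw [← Unitization.inr_star, ← Unitization.inr_star, ← Unitization.inr_mul,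
        ← Unitization.inr_mul, ← Unitization.inr_add, hsum])
  -- The subtracted class `[0]` vanishes by the same criterion, with `w = s = e = 0`.
  have h2 : K00.cls (unitizationProj (0 : A) (.zero A)) = 0 :=
    K00.cls_eq_zero_of_swindle rfl (.zero (Unitization ℂ A)) (w := 0) (s := 0)
      (fun i j => by rw [star_zero, mul_zero]; rfl) (by simp) (by simp) (by simp)
  refine Subtype.ext ?_
  change K00.cls (unitizationProj p hp) - K00.cls (unitizationProj (0 : A) (.zero A)) = 0
  rw [h1, h2, sub_zero]

end KTheory

/-! ## Operators of the form `∑ᵢ |aᵢ⟩⟨bᵢ|` -/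

/-- Split the pairs `(x, n)` according to whether `n = 0`. -/
def prodNatEquiv {α : Type*} : α ⊕ α × ℕ ≃ α × ℕ where
  toFun := Sum.elim (fun x => (x, 0)) fun i => (i.1, i.2 + 1)
  invFun
    | (x, 0) => .inl x
    | (x, k + 1) => .inr (x, k)
  left_inv := by rintro (x | i) <;> rfl
  right_inv := by rintro ⟨x, _ | k⟩ <;> rfl

section SumOp

variable {E ι : Type*} [NormedAddCommGroup E] [InnerProductSpace ℂ E]

/-- `T = ∑ᵢ |aᵢ⟩⟨bᵢ|`, as a strongly convergent sum. -/
def IsSumOp (a b : ι → E) (T : E →L[ℂ] E) : Prop :=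
  ∀ φ, HasSum (fun i => inner ℂ (b i) φ • a i) (T φ)

/-- By Bessel the coefficients `⟨b i, φ⟩` are square summable, and `ha` turns this into the Cauchy
criterion and the norm bound. The vectors `a i` need not be orthogonal, which allows for truncated
Wannier functions. -/
theorem exists_isSumOp [CompleteSpace E] {a b : ι → E} (hb : Orthonormal ℂ b) {C : ℝ} (hC : 0 ≤ C)
    (ha : ∀ (F : Finset ι) (c : ι → ℂ), ‖∑ i ∈ F, c i • a i‖ ^ 2 ≤ C ^ 2 * ∑ i ∈ F, ‖c i‖ ^ 2) :
    ∃ T : E →L[ℂ] E, ‖T‖ ≤ C ∧ IsSumOp a b T := by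
  have hsum : ∀ φ : E, Summable fun i => inner ℂ (b i) φ • a i := by
    intro φ
    rw [summable_iff_vanishing_norm]
    intro ε hε
    obtain ⟨s, hs⟩ := summable_iff_vanishing_norm.1 (hb.inner_products_summable φ)
      -- The `+ 1` covers `C = 0`.
      (ε ^ 2 / (C ^ 2 + 1)) (by positivity)
    refine ⟨s, fun t ht => ?_⟩
    have h1 := hs t ht
    rw [Real.norm_of_nonneg (by positivity), lt_div_iff₀ (by positivity)] at h1
    have h2 := ha t fun i => inner ℂ (b i) φ
    have h3 : 0 ≤ ∑ i ∈ t, ‖inner ℂ (b i) φ‖ ^ 2 := by positivity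
    refine lt_of_pow_lt_pow_left₀ 2 hε.le ?_
    nlinarith
  let L : E →ₗ[ℂ] E :=
    { toFun := fun φ => ∑' i, inner ℂ (b i) φ • a i
      map_add' := fun x y => by
        rw [← (hsum x).tsum_add (hsum y)]
        simp only [inner_add_right, add_smul]
      map_smul' := fun c x => by
        rw [RingHom.id_apply, ← (hsum x).tsum_const_smul c]
        simp only [inner_smul_right, mul_smul] }
  have hL : ∀ φ, ‖L φ‖ ≤ C * ‖φ‖ := by
    intro φ
    refine le_of_tendsto (hsum φ).hasSum.norm (.of_forall fun F => ?_)
    refine (pow_le_pow_iff_left₀ (norm_nonneg _) (by positivity) two_ne_zero).1 ?_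
    rw [mul_pow]
    exact (ha F _).trans (mul_le_mul_of_nonneg_left (hb.sum_inner_products_le φ) (by positivity))
  exact ⟨L.mkContinuous C hL, L.mkContinuous_norm_le hC hL, fun φ => (hsum φ).hasSum⟩

theorem Orthonormal.exists_isSumOp [CompleteSpace E] {a b : ι → E} (ha : Orthonormal ℂ a)
    (hb : Orthonormal ℂ b) : ∃ T : E →L[ℂ] E, IsSumOp a b T := by
  obtain ⟨T, -, hT⟩ := _root_.exists_isSumOp (a := a) hb zero_le_one fun F c => by
    have h : inner ℂ (∑ i ∈ F, c i • a i) (∑ i ∈ F, c i • a i) = ∑ i ∈ F, (‖c i‖ ^ 2 : ℂ) := by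
      rw [ha.inner_sum]
      exact Finset.sum_congr rfl fun i _ => RCLike.conj_mul (c i)
    rw [inner_self_eq_norm_sq_to_K] at h
    rw [one_pow, one_mul]
    exact le_of_eq (Complex.ofReal_injective (by push_cast; exact h))
  exact ⟨T, hT⟩

namespace IsSumOp

variable {a b c : ι → E} {S T : E →L[ℂ] E}

theorem unique (hS : IsSumOp a b S) (hT : IsSumOp a b T) : S = T := by
  ext φ
  exact (hS φ).unique (hT φ)

theorem star [CompleteSpace E] (hT : IsSumOp a b T) (hS : IsSumOp b a S) : star T = S := by
  rw [ContinuousLinearMap.star_eq_adjoint, eq_comm, ContinuousLinearMap.eq_adjoint_iff]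
  intro φ χ
  have h1 := (hT χ).mapL (innerSL ℂ φ)
  have h2 := ((hS φ).mapL (innerSL ℂ χ)).star
  simp only [innerSL_apply_apply, inner_smul_right, Complex.star_def, map_mul,
    inner_conj_symm] at h1 h2
  refine h2.unique ?_
  convert h1 using 2
  ring

theorem apply_eq_zero (hT : IsSumOp a b T) {φ : E} (h : ∀ i, inner ℂ (b i) φ = 0) : T φ = 0 := by
  refine (hT φ).unique ?_
  simp [h]

theorem apply_self (hT : IsSumOp a b T) (hb : Orthonormal ℂ b) (i : ι) : T (b i) = a i := by
  classical
  refine (hT (b i)).unique ?_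
  convert hasSum_single i fun j hj => ?_ using 1
  · simp [hb.1 i]
  · rw [hb.2 hj, zero_smul]

theorem comp_left {A : E →L[ℂ] E} {a' : ι → E} (hT : IsSumOp a b T) (h : ∀ i, A (a i) = a' i) :
    IsSumOp a' b (A * T) := fun φ => by
  simpa [h] using (hT φ).mapL A

theorem mul (hS : IsSumOp a b S) (hT : IsSumOp b c T) (hb : Orthonormal ℂ b) :
    IsSumOp a c (S * T) :=
  hT.comp_left (hS.apply_self hb)

theorem mul_eq_zero {κ : Type*} {a' b' : κ → E} (hS : IsSumOp a b S) (hT : IsSumOp a' b' T)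
    (h : ∀ i j, inner ℂ (b i) (a' j) = 0) : S * T = 0 := by
  ext φ
  have h1 := hT.comp_left (A := S) (a' := 0) fun j => hS.apply_eq_zero fun i => h i j
  refine (h1 φ).unique ?_
  simp

theorem sub {a' : ι → E} (hS : IsSumOp a b S) (hT : IsSumOp a' b T) :
    IsSumOp (fun i => a i - a' i) b (S - T) := fun φ => by
  simpa [smul_sub] using (hS φ).sub (hT φ)

theorem add_of_equiv {κ κ' : Type*} {a₁ b₁ : κ → E} {a₂ b₂ : κ' → E} (hS : IsSumOp a₁ b₁ S)
    (hT : IsSumOp a₂ b₂ T) (e : κ ⊕ κ' ≃ ι) (ha₁ : ∀ k, a (e (.inl k)) = a₁ k)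
    (hb₁ : ∀ k, b (e (.inl k)) = b₁ k) (ha₂ : ∀ k, a (e (.inr k)) = a₂ k)
    (hb₂ : ∀ k, b (e (.inr k)) = b₂ k) : IsSumOp a b (S + T) := fun φ => by
  rw [← e.hasSum_iff]
  refine HasSum.sum (a := S φ) (b := T φ) ?_ ?_
  · simpa only [Function.comp_def, ha₁, hb₁] using hS φ
  · simpa only [Function.comp_def, ha₂, hb₂] using hT φ

theorem isStarProjection [CompleteSpace E] (hT : IsSumOp a a T) (ha : Orthonormal ℂ a) :
    IsStarProjection T :=
  ⟨(hT.mul hT ha).unique hT, hT.star hT⟩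

/-- `T φ` is a limit of elements of the span, and `φ - T φ` is orthogonal to every `a i`, hence to
`K`. -/
theorem eq_starProjection [CompleteSpace E] (hT : IsSumOp a a T) (ha : Orthonormal ℂ a)
    {K : Submodule ℂ E} [K.HasOrthogonalProjection]
    (hK : (Submodule.span ℂ (Set.range a)).topologicalClosure = K) : T = K.starProjection := by
  ext φ
  refine (Submodule.eq_starProjection_of_mem_of_inner_eq_zero ?_ fun w hw => ?_).symm
  · have hc : IsClosed (K : Set E) := by
      rw [← hK]
      exact Submodule.isClosed_topologicalClosure _
    refine hc.mem_of_tendsto (hT φ) (.of_forall fun F => K.sum_mem fun i _ => K.smul_mem _ ?_)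
    rw [← hK]
    exact Submodule.le_topologicalClosure _ (Submodule.subset_span ⟨i, rfl⟩)
  · have h0 : ∀ i, inner ℂ (φ - T φ) (a i) = 0 := fun i => by
      have h1 : inner ℂ (T φ) (a i) = inner ℂ φ (T (a i)) := by
        rw [← ContinuousLinearMap.adjoint_inner_left, ← ContinuousLinearMap.star_eq_adjoint,
          hT.star hT]
      rw [inner_sub_left, h1, hT.apply_self ha, sub_self]
    have hle : (Submodule.span ℂ (Set.range a)).topologicalClosure ≤
        (ℂ ∙ (φ - T φ))ᗮ := by
      refine Submodule.topologicalClosure_minimal _ (Submodule.span_le.2 ?_)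
        (Submodule.isClosed_orthogonal _)
      rintro _ ⟨i, rfl⟩
      exact Submodule.mem_orthogonal_singleton_iff_inner_right.2 (h0 i)
    rw [hK] at hle
    exact Submodule.mem_orthogonal_singleton_iff_inner_right.1 (hle hw)

end IsSumOp

end SumOp

/-! ### Local compactness and propagation of sum operators -/

namespace Roe

variable {d : ℕ} {ι : Type*}

theorem mulOp_apply_eq_zero {f : C_c(Pos d, ℂ)} {φ : L2 d} {B : Set (Pos d)}
    (hφ : ∀ᵐ x, x ∉ B → φ x = 0) (hf : Disjoint (tsupport f) B) : mulOp f φ = 0 := by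
  refine Lp.ext ?_
  filter_upwards [mulOp_ae f φ, hφ, Lp.coeFn_zero ℂ 2 (volume : Measure (Pos d))] with x h1 h2 h3
  rw [h1, h3, Pi.zero_apply]
  by_cases hx : x ∈ B
  · rw [image_eq_zero_of_notMem_tsupport fun h => hf.le_bot ⟨h, hx⟩, zero_mul]
  · rw [h2 hx, mul_zero]

theorem inner_mulOp_right (f : C_c(Pos d, ℂ)) (φ χ : L2 d) :
    inner ℂ χ (mulOp f φ) = inner ℂ (mulOp (star f) χ) φ := by
  rw [mulOp_star, ContinuousLinearMap.star_eq_adjoint, ContinuousLinearMap.adjoint_inner_left]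

theorem finite_not_disjoint_ball {p : ι → Pos d} (hp : ∀ R, {i | ‖p i‖ ≤ R}.Finite) (ρ : ℝ)
    {K : Set (Pos d)} (hK : IsCompact K) : {i | ¬ Disjoint K (Metric.ball (p i) ρ)}.Finite := by
  obtain ⟨r, hr⟩ := hK.isBounded.subset_closedBall 0
  refine (hp (r + ρ)).subset fun i hi => ?_
  obtain ⟨x, hx, hxi⟩ := Set.not_disjoint_iff.1 hi
  have h1 := hr hx
  rw [mem_closedBall_zero_iff] at h1
  rw [Metric.mem_ball, dist_comm, dist_eq_norm] at hxi
  have := norm_le_norm_add_norm_sub' (p i) x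
  change ‖p i‖ ≤ _
  linarith

theorem isCompactOperator_of_isSumOp_of_finite {a b : ι → L2 d} {T : BL2 d} (hT : IsSumOp a b T)
    {s : Set ι} (hs : s.Finite) (h : ∀ i ∉ s, a i = 0 ∨ b i = 0) : IsCompactOperator T := by
  have hT' : ∀ φ, T φ = ∑ i ∈ hs.toFinset, inner ℂ (b i) φ • a i := fun φ =>
    (hT φ).unique <| hasSum_sum_of_ne_finset_zero fun i hi => by
      rcases h i (by simpa using hi) with h | h <;> simp [h]
  have h1 : (T : L2 d → L2 d) = ∑ i ∈ hs.toFinset, fun φ => inner ℂ (b i) φ • a i := by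
    ext1 φ
    rw [hT', Finset.sum_apply]
  rw [h1]
  refine Finset.sum_induction _ (IsCompactOperator (M₁ := L2 d) (M₂ := L2 d))
    (fun _ _ h h' => h.add h') isCompactOperator_zero fun i _ => ?_
  have h2 : IsCompactOperator (ContinuousLinearMap.toSpanSingleton ℂ (a i)) :=
    isCompactOperator_of_locallyCompactSpace_rng _
  exact h2.comp_clm (innerSL ℂ (b i))

/-- Each `|a i⟩⟨b i|` connects only points of one ball of radius `ρ`, so the propagation is at most
`2ρ`. A compact support meets finitely many of these balls, so `T f` and `f T` have finite rank. The
points `p i` may be arbitrarily crowded or repeated, as long as `hp` holds. -/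
theorem mem_algebraicRoe_of_isSumOp {a b : ι → L2 d} {p : ι → Pos d} {ρ : ℝ} (hρ : 0 < ρ)
    (hp : ∀ R, {i | ‖p i‖ ≤ R}.Finite)
    (ha : ∀ i, ∀ᵐ x, x ∉ Metric.ball (p i) ρ → a i x = 0)
    (hb : ∀ i, ∀ᵐ x, x ∉ Metric.ball (p i) ρ → b i x = 0) {T : BL2 d} (hT : IsSumOp a b T) :
    T ∈ algebraicRoe d := by
  have hr : ∀ (f : C_c(Pos d, ℂ)), IsSumOp a (fun i => mulOp (star f) (b i)) (T * mulOp f) :=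
    fun f φ => by
      simp only [← inner_mulOp_right]
      exact hT (mulOp f φ)
  have hl : ∀ (f : C_c(Pos d, ℂ)), IsSumOp (fun i => mulOp f (a i)) b (mulOp f * T) :=
    fun f => hT.comp_left fun _ => rfl
  have ha0 : ∀ (f : C_c(Pos d, ℂ)) i, Disjoint (tsupport f) (Metric.ball (p i) ρ) →
      mulOp f (a i) = 0 := fun f i h => mulOp_apply_eq_zero (ha i) h
  have hb0 : ∀ (f : C_c(Pos d, ℂ)) i, Disjoint (tsupport f) (Metric.ball (p i) ρ) →
      mulOp (star f) (b i) = 0 := fun f i h =>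
    mulOp_apply_eq_zero (hb i) (by rwa [tsupport_star])
  refine ⟨fun f => ⟨?_, ?_⟩, 2 * ρ, by positivity, fun f g hfg => ?_⟩
  · exact isCompactOperator_of_isSumOp_of_finite (hr f)
      (finite_not_disjoint_ball hp ρ f.hasCompactSupport)
      fun i hi => .inr (hb0 f i (not_not.1 hi))
  · exact isCompactOperator_of_isSumOp_of_finite (hl f)
      (finite_not_disjoint_ball hp ρ f.hasCompactSupport)
      fun i hi => .inl (ha0 f i (not_not.1 hi))
  · ext1 φ
    have h : IsSumOp (fun i => mulOp f (a i)) (fun i => mulOp (star g) (b i))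
        (mulOp f * (T * mulOp g)) := (hr g).comp_left fun _ => rfl
    rw [mul_assoc]
    refine (h φ).unique ?_
    refine hasSum_zero.congr_fun fun i => ?_
    change inner ℂ (mulOp (star g) (b i)) φ • mulOp f (a i) = 0
    by_cases hf : Disjoint (tsupport f) (Metric.ball (p i) ρ)
    · rw [ha0 f i hf, smul_zero]
    by_cases hg : Disjoint (tsupport g) (Metric.ball (p i) ρ)
    · rw [hb0 g i hg, inner_zero_left, zero_smul]
    obtain ⟨x, hx, hxi⟩ := Set.not_disjoint_iff.1 hf
    obtain ⟨y, hy, hyi⟩ := Set.not_disjoint_iff.1 hg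
    have h1 : ENNReal.ofReal (2 * ρ) < edist x y :=
      hfg.trans_le (iInf₂_le_of_le x hx (iInf₂_le y hy))
    rw [edist_dist, ENNReal.ofReal_lt_ofReal_iff_of_nonneg (by positivity)] at h1
    rw [Metric.mem_ball] at hxi hyi
    linarith [dist_triangle_right x y (p i)]

/-! ### Uniformly discrete sets -/

namespace UniformlyDiscrete

variable {D : Set (Pos d)}

theorem countable (hD : UniformlyDiscrete D) : D.Countable := by
  obtain ⟨r, hr, h⟩ := hD
  exact h.countable_of_isOpen (fun _ _ => Metric.isOpen_ball) fun _ _ => Metric.nonempty_ball.2 hr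

/-- Volume packing: disjoint balls of equal positive volume inside `B_(R+r)(0)`. -/
theorem finite_norm_le (hD : UniformlyDiscrete D) (R : ℝ) : {γ : D | ‖(γ : Pos d)‖ ≤ R}.Finite := by
  obtain ⟨r, hr, h⟩ := hD
  have h1 := Measure.finite_const_le_meas_of_disjoint_iUnion
    (volume.restrict (Metric.ball (0 : Pos d) (R + r)))
    (ε := volume (Metric.ball (0 : Pos d) r)) (Metric.measure_ball_pos _ _ hr)
    (As := fun γ : D => Metric.ball (γ : Pos d) r) (fun _ => measurableSet_ball)
    (h.subtype _ _) (ne_top_of_le_ne_top (measure_ball_ne_top (x := (0 : Pos d)) (r := R + r))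
      ((measure_mono (Set.subset_univ _)).trans_eq (Measure.restrict_apply_univ _)))
  refine h1.subset fun γ hγ => ?_
  rw [Set.mem_ofPred_eq]
  rw [Measure.restrict_apply measurableSet_ball, Set.inter_eq_left.2,
    Measure.addHaar_ball_center volume (γ : Pos d)]
  refine Metric.ball_subset_ball' ?_
  rw [dist_zero_right]
  linarith [show ‖(γ : Pos d)‖ ≤ R from hγ]

/-- The sums `∑_γ ⟨x - γ⟩^(-2s)` over the points of a uniformly discrete set at distance at least
`R` from `x` are uniformly small for large `R`, if `s > d/2`. -/
theorem exists_sum_tail_le (hD : UniformlyDiscrete D) {s : ℝ} (hs : (d : ℝ) / 2 < s) {ε : ℝ}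
    (hε : 0 < ε) : ∃ R : ℝ, 0 < R ∧ ∀ (x : Pos d) (F : Finset D),
      ∑ γ ∈ F, (if R ≤ ‖x - γ‖ then (1 + ‖x - γ‖ ^ 2) ^ (-s) else 0) ≤ ε := by
  obtain ⟨r, hr, h⟩ := hD
  have hs0 : 0 < s := lt_of_le_of_lt (by positivity) hs
  -- The sum is compared with an integral of `g` over the disjoint balls `B_r(γ)`; `g` is integrable
  -- because `2s > d`.
  let g : Pos d → ℝ := fun y => (1 + ‖y‖ ^ 2) ^ (-s)
  have hg0 : ∀ y, 0 ≤ g y := fun y => by positivity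
  have hg : Integrable g := by
    have := integrable_rpow_neg_one_add_norm_sq (E := Pos d) (μ := volume) (r := 2 * s)
      (by rw [finrank_euclideanSpace_fin]; linarith)
    convert this using 4
    ring
  let A : ℕ → Set (Pos d) := fun n => {z | (n : ℝ) ≤ ‖z‖}
  have hA : ∀ n, MeasurableSet (A n) := fun n => measurableSet_le measurable_const measurable_norm
  have hlim : Filter.Tendsto (fun n => ∫ z, (A n).indicator g z) Filter.atTop (nhds 0) := by
    have := tendsto_integral_of_dominated_convergence (μ := (volume : Measure (Pos d)))
      (F := fun n => (A n).indicator g) (f := fun _ => (0 : ℝ)) g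
      (fun n => hg.aestronglyMeasurable.indicator (hA n)) hg
      (fun n => .of_forall fun z => (norm_indicator_le_norm_self _ _).trans
        (Real.norm_of_nonneg (hg0 z)).le)
      (.of_forall fun z => by
        obtain ⟨N, hN⟩ := exists_nat_gt ‖z‖
        refine tendsto_const_nhds.congr' ?_
        filter_upwards [Filter.eventually_ge_atTop N] with n hn
        refine (Set.indicator_of_notMem (s := A n) (fun hz : (n : ℝ) ≤ ‖z‖ => ?_) g).symm
        have : (N : ℝ) ≤ n := by exact_mod_cast hn
        linarith)
    simpa using this
  -- For `‖y - γ‖ < r` one has `1 + ‖x - y‖² ≤ (2 + 2r²)(1 + ‖x - γ‖²)`, so `g` varies on the ball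
  -- by at most the factor `K`.
  let K : ℝ := (2 + 2 * r ^ 2) ^ s
  have hK : 0 < K := by positivity
  let v : ℝ := volume.real (Metric.ball (0 : Pos d) r)
  have hv : 0 < v := ENNReal.toReal_pos (Metric.measure_ball_pos _ _ hr).ne' measure_ball_ne_top
  obtain ⟨n, hn⟩ := (hlim.eventually (gt_mem_nhds (show 0 < ε * v / K by positivity))).exists
  -- The extra `r` keeps the whole ball `B_r(γ)` at distance at least `n` from `x`.
  refine ⟨n + r, by positivity, fun x F => ?_⟩
  have hint : Integrable fun y => (A n).indicator g (x - y) :=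
    (hg.indicator (hA n)).comp_sub_left x
  have hterm : ∀ γ : D, (if n + r ≤ ‖x - γ‖ then (1 + ‖x - γ‖ ^ 2) ^ (-s) else 0) ≤
      K / v * ∫ y in Metric.ball (γ : Pos d) r, (A n).indicator g (x - y) := by
    intro γ
    split_ifs with hγ
    · have h1 : ∀ y ∈ Metric.ball (γ : Pos d) r,
          (1 + ‖x - γ‖ ^ 2) ^ (-s) / K ≤ (A n).indicator g (x - y) := by
        intro y hy
        rw [Metric.mem_ball, dist_eq_norm] at hy
        have e1 : ‖x - γ‖ ≤ ‖x - y‖ + ‖y - γ‖ := norm_sub_le_norm_sub_add_norm_sub _ _ _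
        have e2 : ‖x - y‖ ≤ ‖x - γ‖ + ‖y - γ‖ := by
          rw [norm_sub_rev y]
          exact norm_sub_le_norm_sub_add_norm_sub _ _ _
        rw [Set.indicator_of_mem (show x - y ∈ A n from (by linarith : (n : ℝ) ≤ ‖x - y‖))]
        change _ ≤ (1 + ‖x - y‖ ^ 2) ^ (-s)
        rw [Real.rpow_neg (by positivity), Real.rpow_neg (by positivity), inv_eq_one_div, div_div,
          ← Real.mul_rpow (by positivity) (by positivity), ← inv_eq_one_div]
        refine inv_anti₀ (by positivity) (Real.rpow_le_rpow (by positivity) ?_ hs0.le)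
        have e3 : ‖x - y‖ ≤ ‖x - γ‖ + r := by linarith
        have e4 : ‖x - y‖ ^ 2 ≤ (‖x - γ‖ + r) ^ 2 := by gcongr
        nlinarith [sq_nonneg (‖x - γ‖ - r), mul_nonneg (sq_nonneg ‖x - γ‖) (sq_nonneg r)]
      have h2 := setIntegral_ge_of_const_le_real (measurableSet_ball (x := (γ : Pos d)) (ε := r))
        measure_ball_ne_top h1 hint.integrableOn
      have h3 : volume.real (Metric.ball (γ : Pos d) r) = v := by
        simp only [Measure.real, v, Measure.addHaar_ball_center]
      rw [h3] at h2
      calc (1 + ‖x - γ‖ ^ 2) ^ (-s) = K / v * ((1 + ‖x - γ‖ ^ 2) ^ (-s) / K * v) := by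
            field_simp
        _ ≤ _ := by gcongr
    · refine mul_nonneg (by positivity) (integral_nonneg fun y => ?_)
      exact Set.indicator_nonneg (fun y _ => hg0 y) _
  calc _ ≤ ∑ γ ∈ F, K / v * ∫ y in Metric.ball (γ : Pos d) r, (A n).indicator g (x - y) :=
        Finset.sum_le_sum fun γ _ => hterm γ
    _ = K / v * ∫ y in ⋃ γ ∈ F, Metric.ball (γ : Pos d) r, (A n).indicator g (x - y) := by
        rw [← Finset.mul_sum, integral_biUnion_finset _ (fun _ _ => measurableSet_ball)
          ((h.subtype _ _).set_pairwise _) fun _ _ => hint.integrableOn]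
    _ ≤ K / v * ∫ y, (A n).indicator g (x - y) := by
        refine mul_le_mul_of_nonneg_left (setIntegral_le_integral hint (.of_forall fun y => ?_))
          (by positivity)
        exact Set.indicator_nonneg (fun y _ => hg0 y) _
    _ = K / v * ∫ z, (A n).indicator g z := by
        rw [integral_sub_left_eq_self (fun z => (A n).indicator g z) volume x]
    _ ≤ K / v * (ε * v / K) := by gcongr
    _ = ε := by field_simp

end UniformlyDiscrete

end Roe

namespace Roe

variable {d : ℕ}

/-! ### Localized orthonormal families -/

/-- Orthogonality comes from disjoint supports even when the points `p i` coincide. Each index gets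
its own interval of values of `sin (x j)`; by periodicity the corresponding open set meets every
ball of radius `8 > 2π`. The normalized indicators of the intersections serve as `η`. -/
theorem exists_orthonormal_localized (hd : 1 ≤ d) {ι : Type*} [Countable ι] (p : ι → Pos d) :
    ∃ η : ι → L2 d, Orthonormal ℂ η ∧ ∀ i, ∀ᵐ x, x ∉ Metric.ball (p i) 8 → η i x = 0 := by
  obtain ⟨n, hn⟩ := exists_injective_nat ι
  let j : Fin d := ⟨0, hd⟩
  let I : ℕ → Set ℝ := fun k => Set.Ioo (1 / ((k : ℝ) + 2)) (1 / ((k : ℝ) + 1))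
  have hI : ∀ {k l : ℕ} {y : ℝ}, y ∈ I k → y ∈ I l → k ≤ l := by
    intro k l y hk hl
    have h1 : 1 / ((l : ℝ) + 2) < 1 / ((k : ℝ) + 1) := hl.1.trans hk.2
    rw [one_div_lt_one_div (by positivity) (by positivity)] at h1
    have h2 : k + 1 < l + 2 := by exact_mod_cast h1
    omega
  let A : ι → Set (Pos d) := fun i => {x | Real.sin (x j) ∈ I (n i)} ∩ Metric.ball (p i) 8
  have hAo : ∀ i, IsOpen (A i) := fun i =>
    (isOpen_Ioo.preimage (by fun_prop : Continuous fun x : Pos d => Real.sin (x j))).inter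
      Metric.isOpen_ball
  have hAn : ∀ i, (A i).Nonempty := by
    intro i
    obtain ⟨y, hy⟩ : (I (n i)).Nonempty := Set.nonempty_Ioo.2
      (one_div_lt_one_div_of_lt (by positivity) (by linarith))
    have hy0 : 0 < y := lt_trans (by positivity) hy.1
    have hy1 : y < 1 := hy.2.trans_le
      ((div_le_one (by positivity)).2 (by linarith [Nat.cast_nonneg (α := ℝ) (n i)]))
    -- The translate of `arcsin y` by a multiple of `2π` that lies in `[p i j, p i j + 2π)`.
    let z := toIcoMod Real.two_pi_pos (p i j) (Real.arcsin y)
    have hz := toIcoMod_mem_Ico Real.two_pi_pos (p i j) (Real.arcsin y)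
    have hsz : Real.sin z = y := by
      have : z = Real.arcsin y - toIcoDiv Real.two_pi_pos (p i j) (Real.arcsin y) • (2 * Real.pi) :=
        (self_sub_toIcoDiv_zsmul _ _ _).symm
      rw [this, zsmul_eq_mul, Real.sin_sub_int_mul_two_pi,
        Real.sin_arcsin (by linarith) hy1.le]
    refine ⟨p i + EuclideanSpace.single j (z - p i j), ?_, ?_⟩
    · rw [Set.mem_ofPred_eq]
      simpa [hsz] using hy
    · rw [mem_ball_iff_norm, add_sub_cancel_left, PiLp.norm_single, Real.norm_eq_abs,
        abs_of_nonneg (sub_nonneg.2 hz.1)]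
      have := hz.2
      change z < _ at this
      linarith [Real.pi_lt_d2]
  have hAd : ∀ {i k}, i ≠ k → A i ∩ A k = ∅ := fun {i k} hik =>
    Set.eq_empty_of_forall_notMem fun x hx =>
      hik (hn ((hI hx.1.1 hx.2.1).antisymm (hI hx.2.1 hx.1.1)))
  have hfin : ∀ i, volume (A i) ≠ ∞ := fun i =>
    ne_top_of_le_ne_top measure_ball_ne_top (measure_mono Set.inter_subset_right)
  have hpos : ∀ i, 0 < volume.real (A i) := fun i =>
    ENNReal.toReal_pos ((hAo i).measure_pos _ (hAn i)).ne' (hfin i)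
  let c : ι → ℂ := fun i => ((Real.sqrt (volume.real (A i)))⁻¹ : ℝ)
  refine ⟨fun i => indicatorConstLp 2 (hAo i).measurableSet (hfin i) (c i), ⟨fun i => ?_,
    fun i k hik => ?_⟩, fun i => ?_⟩
  · rw [norm_indicatorConstLp two_ne_zero ENNReal.ofNat_ne_top, Complex.norm_real,
      Real.norm_of_nonneg (by positivity), Real.sqrt_eq_rpow, ENNReal.toReal_ofNat]
    exact inv_mul_cancel₀ (Real.rpow_pos_of_pos (hpos i) _).ne'
  · change inner ℂ (indicatorConstLp 2 _ _ _) (indicatorConstLp 2 _ _ _) = 0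
    rw [L2.inner_indicatorConstLp_indicatorConstLp, hAd hik, measureReal_empty, zero_smul]
  · filter_upwards [indicatorConstLp_coeFn_notMem (p := 2) (hs := (hAo i).measurableSet)
      (hμs := hfin i) (c := c i)] with x hx hxb
    exact hx fun h => hxb h.2

/-! ### Truncation of localized families -/

theorem ofReal_norm_sq (u : L2 d) :
    ENNReal.ofReal (‖u‖ ^ 2) = ∫⁻ x, ENNReal.ofReal (‖u x‖ ^ 2) := by
  have h := eLpNorm_nnreal_pow_eq_lintegral (f := u) (μ := volume) (p := 2) two_ne_zero
  have h1 : ∀ y : ℝ≥0∞, y ^ ((2 : NNReal) : ℝ) = y ^ 2 := fun y => by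
    rw [← ENNReal.rpow_natCast]; norm_num
  simp only [h1, ENNReal.coe_ofNat] at h
  rw [ENNReal.ofReal_pow (norm_nonneg _), ofReal_norm, Lp.enorm_def]
  simpa only [ENNReal.ofReal_pow (norm_nonneg _), ofReal_norm] using h

theorem bracket_rpow (x : Pos d) (s : ℝ) : bracket x ^ (2 * s) = (1 + ‖x‖ ^ 2) ^ s := by
  rw [bracket, Real.sqrt_eq_rpow, ← Real.rpow_mul (by positivity)]
  congr 1
  ring

/-- Cauchy–Schwarz at each point `x`, with weights `⟨x - γ⟩^s` and `⟨x - γ⟩^(-s)`: the second factor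
is the tail sum, at most `ε`, and the first integrates to at most `M ∑ ‖c γ‖²`. No orthogonality of
the `θ γ` enters. -/
theorem norm_sum_tail_sq_le {D : Set (Pos d)} {ψ θ : D → L2 d} {s R ε M : ℝ} (hε : 0 ≤ ε)
    (hM : 0 ≤ M)
    (hψ : ∀ γ : D, ∫⁻ x, ENNReal.ofReal (bracket (x - (γ : Pos d)) ^ (2 * s) * ‖ψ γ x‖ ^ 2) ≤
      ENNReal.ofReal M)
    (hθ : ∀ γ : D, ∀ᵐ x, θ γ x = if R ≤ ‖x - γ‖ then ψ γ x else 0)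
    (htail : ∀ (x : Pos d) (F : Finset D),
      ∑ γ ∈ F, (if R ≤ ‖x - γ‖ then (1 + ‖x - γ‖ ^ 2) ^ (-s) else 0) ≤ ε)
    (F : Finset D) (c : D → ℂ) :
    ‖∑ γ ∈ F, c γ • θ γ‖ ^ 2 ≤ ε * M * ∑ γ ∈ F, ‖c γ‖ ^ 2 := by
  let w : D → Pos d → ℝ := fun γ x => bracket (x - (γ : Pos d)) ^ (2 * s) * ‖ψ γ x‖ ^ 2
  have hw0 : ∀ γ x, 0 ≤ w γ x := fun γ x => by
    simp only [w, bracket_rpow]; positivity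
  have hwm : ∀ γ, AEMeasurable fun x => ENNReal.ofReal (w γ x) := fun γ => by
    have h1 : Continuous fun x : Pos d => bracket (x - (γ : Pos d)) ^ (2 * s) := by
      simp only [bracket_rpow]
      exact (by fun_prop : Continuous fun x : Pos d => 1 + ‖x - (γ : Pos d)‖ ^ 2).rpow_const
        fun x => .inl (by positivity)
    exact (h1.aemeasurable.mul
      ((Lp.aestronglyMeasurable (ψ γ)).norm.aemeasurable.pow_const 2)).ennreal_ofReal
  have hpt : ∀ᵐ x, ‖(∑ γ ∈ F, c γ • θ γ : L2 d) x‖ ^ 2 ≤ ∑ γ ∈ F, ε * ‖c γ‖ ^ 2 * w γ x := by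
    have h1 : ∀ᵐ x, ∀ γ ∈ F, (c γ • θ γ : L2 d) x = c γ * θ γ x := by
      rw [Filter.eventually_all_finset]
      exact fun γ _ => Lp.coeFn_smul (c γ) (θ γ)
    have h2 : ∀ᵐ x, ∀ γ ∈ F, θ γ x = if R ≤ ‖x - γ‖ then ψ γ x else 0 := by
      rw [Filter.eventually_all_finset]
      exact fun γ _ => hθ γ
    filter_upwards [Lp.coeFn_finsetSum F fun γ => c γ • θ γ, h1, h2] with x e0 e1 e2
    rw [e0, Finset.sum_apply]
    let t : D → ℝ := fun γ => 1 + ‖x - (γ : Pos d)‖ ^ 2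
    have ht : ∀ γ, 0 < t γ := fun γ => by positivity
    let u : D → ℝ := fun γ => ‖c γ‖ * (t γ ^ (s / 2) * ‖ψ γ x‖)
    let v : D → ℝ := fun γ => if R ≤ ‖x - γ‖ then t γ ^ (-(s / 2)) else 0
    have hsq : ∀ γ (a : ℝ), (t γ ^ (a / 2)) ^ 2 = t γ ^ a := fun γ a => by
      rw [← Real.rpow_natCast, ← Real.rpow_mul (ht γ).le]
      congr 1
      push_cast
      ring
    have hu : ∀ γ, u γ ^ 2 = ‖c γ‖ ^ 2 * w γ x := fun γ => by
      simp only [u, w, bracket_rpow, mul_pow, hsq]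
      rfl
    have hv : ∀ γ, v γ ^ 2 = if R ≤ ‖x - γ‖ then (1 + ‖x - γ‖ ^ 2) ^ (-s) else 0 := fun γ => by
      simp only [v]
      split_ifs
      · rw [← neg_div, hsq]
      · simp
    have huv : ∀ γ ∈ F, ‖(c γ • θ γ : L2 d) x‖ = u γ * v γ := fun γ hγ => by
      rw [e1 γ hγ, e2 γ hγ, norm_mul]
      simp only [u, v]
      split_ifs
      · rw [Real.rpow_neg (ht γ).le]
        have := Real.rpow_pos_of_pos (ht γ) (s / 2)
        field_simp
      · simp
    calc ‖∑ γ ∈ F, (c γ • θ γ : L2 d) x‖ ^ 2 ≤ (∑ γ ∈ F, u γ * v γ) ^ 2 := by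
          gcongr
          exact (norm_sum_le _ _).trans_eq (Finset.sum_congr rfl huv)
      _ ≤ (∑ γ ∈ F, u γ ^ 2) * ∑ γ ∈ F, v γ ^ 2 := Finset.sum_mul_sq_le_sq_mul_sq _ _ _
      _ ≤ (∑ γ ∈ F, u γ ^ 2) * ε := by
          gcongr
          simpa only [hv] using htail x F
      _ = ∑ γ ∈ F, ε * ‖c γ‖ ^ 2 * w γ x := by
          rw [Finset.sum_mul]
          exact Finset.sum_congr rfl fun γ _ => by rw [hu]; ring
  rw [← ENNReal.ofReal_le_ofReal_iff (by positivity), ofReal_norm_sq]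
  calc _ ≤ ∫⁻ x, ∑ γ ∈ F, ENNReal.ofReal (ε * ‖c γ‖ ^ 2) * ENNReal.ofReal (w γ x) := by
        refine lintegral_mono_ae (hpt.mono fun x hx => (ENNReal.ofReal_le_ofReal hx).trans_eq ?_)
        rw [ENNReal.ofReal_sum_of_nonneg fun γ _ => by have := hw0 γ x; positivity]
        exact Finset.sum_congr rfl fun γ _ => ENNReal.ofReal_mul (by positivity)
    _ = ∑ γ ∈ F, ENNReal.ofReal (ε * ‖c γ‖ ^ 2) * ∫⁻ x, ENNReal.ofReal (w γ x) := by
        rw [lintegral_finsetSum' _ fun γ _ => (hwm γ).const_mul _]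
        exact Finset.sum_congr rfl fun γ _ => lintegral_const_mul'' _ (hwm γ)
    _ ≤ ∑ γ ∈ F, ENNReal.ofReal (ε * ‖c γ‖ ^ 2) * ENNReal.ofReal M := by
        gcongr with γ
        exact hψ γ
    _ = ENNReal.ofReal (ε * M * ∑ γ ∈ F, ‖c γ‖ ^ 2) := by
        rw [Finset.mul_sum, ENNReal.ofReal_sum_of_nonneg fun γ _ => by positivity]
        refine Finset.sum_congr rfl fun γ _ => ?_
        rw [← ENNReal.ofReal_mul (by positivity)]
        congr 1
        ring

theorem mem_roeAlgebra_of_isSumOp {D : Set (Pos d)} (hD : UniformlyDiscrete D) {s : ℝ}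
    (hs : (d : ℝ) / 2 < s) {ψ η : D → L2 d} {M : ℝ} (hM : 0 < M)
    (hψ : ∀ γ : D, ∫⁻ x, ENNReal.ofReal (bracket (x - (γ : Pos d)) ^ (2 * s) * ‖ψ γ x‖ ^ 2) ≤
      ENNReal.ofReal M)
    (hη : Orthonormal ℂ η) {ρ : ℝ}
    (hηs : ∀ γ : D, ∀ᵐ x, x ∉ Metric.ball (γ : Pos d) ρ → η γ x = 0)
    {T : BL2 d} (hT : IsSumOp ψ η T) : T ∈ roeAlgebra d := by
  change T ∈ closure (algebraicRoe d : Set (BL2 d))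
  rw [Metric.mem_closure_iff]
  intro ε hε
  -- Chosen so that tail times `M` is `(ε / 2)²`, the squared norm bound for the discarded part.
  obtain ⟨R, hR, htail⟩ := hD.exists_sum_tail_le hs (ε := (ε / 2) ^ 2 / M) (by positivity)
  have hmeas : ∀ γ : D, MeasurableSet {x : Pos d | R ≤ ‖x - γ‖} := fun γ =>
    (isClosed_le continuous_const (by fun_prop)).measurableSet
  -- The far part of `ψ γ`; the near part `ψ γ - θ γ` is supported in `B_R(γ)`.
  let θ : D → L2 d := fun γ => ((Lp.memLp (ψ γ)).indicator (hmeas γ)).toLp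
  have hθ : ∀ γ : D, ∀ᵐ x, θ γ x = if R ≤ ‖x - γ‖ then ψ γ x else 0 := fun γ => by
    filter_upwards [((Lp.memLp (ψ γ)).indicator (hmeas γ)).coeFn_toLp] with x hx
    rw [hx, Set.indicator_apply]
    rfl
  obtain ⟨S, hSn, hS⟩ := exists_isSumOp (a := θ) hη (C := ε / 2) (by positivity) fun F c => by
    have := norm_sum_tail_sq_le (by positivity) hM.le hψ hθ htail F c
    rwa [div_mul_cancel₀ _ hM.ne'] at this
  refine ⟨T - S, ?_, ?_⟩
  · refine mem_algebraicRoe_of_isSumOp (p := fun γ : D => (γ : Pos d)) (ρ := max R ρ)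
      (lt_max_of_lt_left hR) hD.finite_norm_le (fun γ => ?_) (fun γ => ?_) (hT.sub hS)
    · filter_upwards [hθ γ, Lp.coeFn_sub (ψ γ) (θ γ)] with x h1 h2 hx
      rw [mem_ball_iff_norm, not_lt] at hx
      rw [h2, Pi.sub_apply, h1, if_pos ((le_max_left _ _).trans hx), sub_self]
    · filter_upwards [hηs γ] with x h1 hx
      exact h1 fun h => hx (Metric.ball_subset_ball (le_max_right _ _) h)
  · rw [dist_eq_norm, sub_sub_cancel]
    linarith

/-! ### The radial swindle -/

theorem exists_radial_direction (hd : 1 ≤ d) (x : Pos d) : ∃ u : Pos d, ‖u‖ = 1 ∧ x = ‖x‖ • u := by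
  by_cases hx : x = 0
  · exact ⟨EuclideanSpace.single ⟨0, hd⟩ 1, by simp, by simp [hx]⟩
  · have := norm_ne_zero_iff.2 hx
    refine ⟨‖x‖⁻¹ • x, ?_, ?_⟩
    · rw [norm_smul, norm_inv, norm_norm, inv_mul_cancel₀ this]
    · rw [smul_smul, mul_inv_cancel₀ this, one_smul]


/-- The orthonormal family `η` on `D × ℕ` is spread out along the rays through the points of `D`;
`S` is the shift `η_(γ,k) ↦ η_(γ,k+1)` and `Q` the projection onto the span of `η`. -/
theorem exists_radial_swindle (hd : 1 ≤ d) {D : Set (Pos d)} [Countable D]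
    (hD : ∀ R, {γ : D | ‖(γ : Pos d)‖ ≤ R}.Finite) :
    ∃ (η₀ : D → L2 d) (S Q : BL2 d), Orthonormal ℂ η₀ ∧
      (∀ γ : D, ∀ᵐ x, x ∉ Metric.ball (γ : Pos d) 8 → η₀ γ x = 0) ∧
      S ∈ algebraicRoe d ∧ Q ∈ algebraicRoe d ∧ IsStarProjection Q ∧ star S * S = Q ∧
      (∀ (a : D → L2 d) (V : BL2 d), IsSumOp a η₀ V → V * S = 0) ∧
      ∀ Q₀ : BL2 d, IsSumOp η₀ η₀ Q₀ → Q₀ + S * star S = Q := by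
  choose u hu hxu using fun γ : D => exists_radial_direction hd (γ : Pos d)
  -- Moving radially makes `‖p (γ, k)‖ = ‖γ‖ + k`, so bounded regions contain finitely many `p i`. A
  -- translation in a fixed direction could bring infinitely many of them back near the origin.
  let p : D × ℕ → Pos d := fun i => (‖(i.1 : Pos d)‖ + i.2) • u i.1
  have hp : ∀ i, ‖p i‖ = ‖(i.1 : Pos d)‖ + i.2 := fun i => by
    rw [norm_smul, hu, mul_one, Real.norm_of_nonneg (by positivity)]
  have hp0 : ∀ γ : D, p (γ, 0) = γ := fun γ => by
    simpa [p] using (hxu γ).symm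
  have hfin : ∀ R, {i | ‖p i‖ ≤ R}.Finite := fun R => by
    refine ((hD R).prod (Set.finite_Iic ⌊R⌋₊)).subset fun i hi => ?_
    rw [Set.mem_ofPred_eq, hp] at hi
    have h1 : 0 ≤ ‖(i.1 : Pos d)‖ := norm_nonneg _
    have h2 : (0 : ℝ) ≤ i.2 := Nat.cast_nonneg _
    refine ⟨?_, Nat.le_floor ?_⟩
    · rw [Set.mem_ofPred_eq]; linarith
    · linarith
  obtain ⟨η, hη, hηs⟩ := exists_orthonormal_localized hd p
  let η₀ : D → L2 d := fun γ => η (γ, 0)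
  let η₁ : D × ℕ → L2 d := fun i => η (i.1, i.2 + 1)
  have hη₀ : Orthonormal ℂ η₀ := hη.comp _ fun γ γ' h => congrArg Prod.fst h
  have hη₁ : Orthonormal ℂ η₁ := hη.comp (fun i : D × ℕ => (i.1, i.2 + 1)) fun i i' h => by
    simpa [Prod.ext_iff] using h
  have h01 : ∀ γ i, inner ℂ (η₀ γ) (η₁ i) = 0 := fun γ i => hη.2 (by simp)
  obtain ⟨S, hS⟩ := hη₁.exists_isSumOp hη
  obtain ⟨S', hS'⟩ := hη.exists_isSumOp hη₁
  obtain ⟨Q, hQ⟩ := hη.exists_isSumOp hη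
  have hSS' : star S = S' := hS.star hS'
  have hmono : ∀ i, Metric.ball (p i) 8 ⊆ Metric.ball (p i) 9 := fun i =>
    Metric.ball_subset_ball (by norm_num)
  -- The shift moves centres by exactly `1`, so radius `9` contains both supports.
  have hstep : ∀ i : D × ℕ, Metric.ball (p (i.1, i.2 + 1)) 8 ⊆ Metric.ball (p i) 9 := fun i => by
    refine Metric.ball_subset_ball' ?_
    have : p (i.1, i.2 + 1) - p i = u i.1 := by
      simp only [p, ← sub_smul]
      push_cast
      rw [show ‖(i.1 : Pos d)‖ + ((i.2 : ℝ) + 1) - (‖(i.1 : Pos d)‖ + i.2) = 1 by ring, one_smul]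
    rw [dist_eq_norm, this, hu]
    norm_num
  have hSmem : S ∈ algebraicRoe d :=
    mem_algebraicRoe_of_isSumOp (p := p) (ρ := 9) (by norm_num) hfin
      (fun i => (hηs (i.1, i.2 + 1)).mono fun x hx h => hx fun h' => h (hstep i h'))
      (fun i => (hηs i).mono fun x hx h => hx fun h' => h (hmono i h')) hS
  refine ⟨η₀, S, Q, hη₀, fun γ => by simpa only [hp0] using hηs (γ, 0), hSmem,
    mem_algebraicRoe_of_isSumOp (by norm_num) hfin hηs hηs hQ, hQ.isStarProjection hη, ?_,
    fun a V hV => hV.mul_eq_zero hS h01, fun Q₀ hQ₀ => ?_⟩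
  · rw [hSS']
    exact (hS'.mul hS hη₁).unique hQ
  · rw [hSS']
    exact (hQ₀.add_of_equiv (hS.mul hS' hη) prodNatEquiv (fun _ => rfl) (fun _ => rfl)
      (fun _ => rfl) (fun _ => rfl)).unique hQ

end Roe

/-! ### Assembly: equivalence with the localized projection, then the swindle -/

namespace Roe

set_option maxHeartbeats 1000000 in
theorem exists_K0_cls_eq_zero {d : ℕ} (hd : 1 ≤ d) {D : Set (Pos d)} (hD : UniformlyDiscrete D)
    {s : ℝ} (hs : (d : ℝ) / 2 < s) {ψ : D → L2 d} (hon : Orthonormal ℂ ψ) {M : ℝ} (hM : 0 < M)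
    (hloc : ∀ γ : D, ∫⁻ x, ENNReal.ofReal (bracket (x - (γ : Pos d)) ^ (2 * s) * ‖ψ γ x‖ ^ 2) ≤
      ENNReal.ofReal M) {P : BL2 d} (hP : IsSumOp ψ ψ P) :
    ∃ (P' : roeAlgebra d) (hP' : IsStarProjection P'),
      (P' : BL2 d) = P ∧ KTheory.K0.cls P' hP' = 0 := by
  have := hD.countable.to_subtype
  obtain ⟨η, S, Q, hη, hηs, hS, hQ, hQp, hSQ, hVS, hsum⟩ :=
    exists_radial_swindle hd hD.finite_norm_le
  obtain ⟨V, hV⟩ := hon.exists_isSumOp hη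
  obtain ⟨W, hW⟩ := hη.exists_isSumOp hon
  have hVW : star V = W := hV.star hW
  have hWV : star W = V := hW.star hV
  have hPVW : V * W = P := (hV.mul hW hη).unique hP
  have hVmem : V ∈ roeAlgebra d := mem_roeAlgebra_of_isSumOp hD hs hM hloc hη hηs hV
  have hWmem : W ∈ roeAlgebra d := hVW ▸ star_mem hVmem
  have hPmem : P ∈ roeAlgebra d := hPVW ▸ mul_mem hVmem hWmem
  have hle := (algebraicRoe d).le_topologicalClosure
  have hPp := hP.isStarProjection hon
  let P' : roeAlgebra d := ⟨P, hPmem⟩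
  let Q' : roeAlgebra d := ⟨Q, hle hQ⟩
  have hPp' : IsStarProjection P' :=
    ⟨Subtype.ext hPp.isIdempotentElem, Subtype.ext hPp.isSelfAdjoint⟩
  have hQp' : IsStarProjection Q' :=
    ⟨Subtype.ext hQp.isIdempotentElem, Subtype.ext hQp.isSelfAdjoint⟩
  -- `W = V*` carries the range of `P` onto that of `Q₀ = W W*`, the complement of the range of `S`
  -- in that of `Q`; hence `(W S)` implements `P ⊕ Q ~ Q`.
  refine ⟨P', hPp', rfl, KTheory.K0.cls_eq_zero_of_swindle (e := Q')
    (w := ⟨W, hWmem⟩) (s := ⟨S, hle hS⟩) hPp' hQp' (Subtype.ext ?_) (Subtype.ext hSQ)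
    (Subtype.ext ?_) (Subtype.ext ?_)⟩
  · change star W * W = P
    rw [hWV, hPVW]
  · change star W * S = 0
    rw [hWV, hVS _ _ hV]
  · change W * star W + S * star S = Q
    rw [hWV, hsum _ (hW.mul hV hon)]

end Roe

set_option maxHeartbeats 1000000 in
theorem theorem1 (d : ℕ) (hd : 1 ≤ d) (s : ℝ) (hs : (d : ℝ) / 2 < s)
    (H : ClosedSubmodule ℂ (Roe.L2 d)) (D : Set (Roe.Pos d)) (ψ : D → Roe.L2 d)
    (hψ : Roe.IsGWB s H D ψ) :
    (∀ φ : Roe.L2 d,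
      HasSum (fun γ : D => inner ℂ (ψ γ) φ • ψ γ) (H.toSubmodule.starProjection φ)) ∧
    ∃ (P : Roe.roeAlgebra d) (hP : IsStarProjection P),
      (P : Roe.BL2 d) = H.toSubmodule.starProjection ∧ KTheory.K0.cls P hP = 0 := by
  obtain ⟨hD, hon, hspan, M, hM, hloc⟩ := hψ
  obtain ⟨P, hP⟩ := hon.exists_isSumOp hon
  have hPeq : P = H.toSubmodule.starProjection := hP.eq_starProjection hon hspan
  refine ⟨fun φ => by rw [← hPeq]; exact hP φ, ?_⟩
  obtain ⟨P', hP', hPP', h0⟩ := Roe.exists_K0_cls_eq_zero hd hD hs hon hM hloc hP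
  exact ⟨P', hP', hPP'.trans hPeq, h0⟩
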